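/- **Setting.** Let $S_1\subseteq[d]$, let $f:\mathbb R^d\to\mathbb R$ satisfy $f(\mathbf x)=f(0)+\sum_{p\in S_1}\phi_p(x_p)$ for $\mathbf x\in[-1,1]^d$, where for each $p\in S_1$: $\phi_p(0)=0$; $|\phi_p(x)-\phi_p(y)|\le L|x-y|^{\alpha}$ for all $x,y\in[-1,1]$; and $|\phi_p(x_p^*)|>D_1$ for some $x_p^*\in[-1,1]$. Here $L>0$, $\alpha\in(0,1]$, $D_1>0$. Every query of $f$ at a point $\mathbf x\in[-1,1]^d$ returns $f(\mathbf x)+\eta$ with $\eta\sim\mathcal N(0,\sigma^2)$, $\sigma\ge 0$, the noise being independent across queries. **Algorithm 1** (parameters $m,n,N\in\mathbb N$, $\varepsilon\in(0,1)$, threshold $\epsilon$). Draw $\beta_1,\dots,\beta_n\in\{-1,+1\}^d$ with independent uniform (Rademacher) entries, independent of the noise, and let $B\in\mathbb R^{n\times d}$ have rows $\beta_i^T$. For every $\mathbf x=(x,\dots,x)$ with $x\in\{-1,-\frac{m-1}{m},\dots,\frac{m-1}{m},1\}$ and every $i\in[n]$, let $\mathbf x_i^{\pm}$ be $\mathbf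 x$ with the coordinates $j$ such that $\beta_{i,j}\ne\pm1$ set to $0$; query each of $\mathbf x_i^+,\mathbf x_i^-$ $N$ times, average the $N$ answers, and let $y_i$ be the average at $\mathbf x_i^+$ minus the average at $\mathbf x_i^-$. Let $\hat{\mathbf z}(\mathbf x)$ be any solution of $$\text{(P1)}\qquad \min_{\mathbf z\in\mathbb R^d}\|\mathbf z\|_1\quad\text{s.t.}\quad \|\mathbf y-B\mathbf z\|_2\le\nu .$$ (If (P1) is infeasible, $\hat{\mathbf z}(\mathbf x)$ is arbitrary.) Output $\hat S_1=\bigcup_{\mathbf x}\{p\in[d]:|\hat z(\mathbf x)_p|>\epsilon\}$. **Theorem.** There are absolute constants $C_2,\tilde c_2,c_3>0$ and, for every $\kappa\in(0,1)$, constants $\tilde c_1,c_0>0$ depending only on $\kappa$, such that the following holds whenever $|S_1|\le\kappa d$. Run Algorithm 1 with $$\nu=\sqrt2\,(1+\varepsilon)\sigma\sqrt{n/N},\qquad \epsilon=\frac{\sqrt2\,C_2(1+\varepsilon)\sigma}{\sqrt N},$$ for some $\varepsilon\in(0,1)$, where $$N\ge\left\lfloor\frac{18C_2^2(1+\varepsilon)^2\sigma^2}{D_1^2}\right\rfloor+1,\qquad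 m\ge\left(\frac{3L}{D_1}\right)^{1/\alpha},\qquad n\ge\max\left\{\tilde c_1|S_1|\log\frac{d}{|S_1|},\ \frac{2\log(2m+1)}{c_3\varepsilon^2}\right\}$$ (with $|S_1|\log(d/|S_1|)$ read as $0$ if $S_1=\emptyset$). Then, with probability at least $$1-2\exp(-\tilde c_2n)-2\exp\left(-\frac{c_3\varepsilon^2n}{2}\right),$$ $\hat S_1=S_1$ whichever solutions of (P1) are used. The total number of queries made is $2(2m+1)nN$, and $$2(2m+1)nN\ \ge\ c_0\,\bar c\,|S_1|\log\frac{d}{|S_1|},\qquad \bar c=\Bigl(1+\bigl(\tfrac{3L}{D_1}\bigr)^{1/\alpha}\Bigr)\Bigl(1+\tfrac{\sigma^2}{D_1^2}\Bigr)>1,$$ i.e. it is $\Omega(\bar c\,|S_1|\log(d/|S_1|))$ with $\bar c$ depending only on $L,D_1,\alpha,\sigma$. -/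

import Mathlib

open MeasureTheory ProbabilityTheory
open scoped Matrix

noncomputable section

namespace Spam

/-- `f` is a sparse additive model on the cube `[-1,1]^d` with active variables `S` and univariate
components `φ p`, `p ∈ S`: the representation is anchored at the origin, every component is
Hölder continuous with constant `L` and exponent `α` on `[-1,1]`, and every component exceeds `D`
in absolute value somewhere on `[-1,1]`. -/
structure IsUnivariateSpam {d : ℕ} (f : (Fin d → ℝ) → ℝ) (S : Finset (Fin d))
    (φ : Fin d → ℝ → ℝ) (L α D : ℝ) : Prop where
  repr : ∀ x ∈ Set.Icc (-1 : Fin d → ℝ) 1, f x = f 0 + ∑ p ∈ S, φ p (x p)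
  anchored : ∀ p ∈ S, φ p 0 = 0
  holder : ∀ p ∈ S, ∀ x ∈ Set.Icc (-1 : ℝ) 1, ∀ y ∈ Set.Icc (-1 : ℝ) 1,
    |φ p x - φ p y| ≤ L * |x - y| ^ α
  identifiable : ∀ p ∈ S, ∃ x ∈ Set.Icc (-1 : ℝ) 1, D < |φ p x|

/-! ### The program (P1) -/

/-- Feasibility for (P1): `‖y - B z‖₂ ≤ ν`. -/
def IsFeasible {n d : ℕ} (B : Matrix (Fin n) (Fin d) ℝ) (y : Fin n → ℝ) (ν : ℝ)
    (z : Fin d → ℝ) : Prop :=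
  ‖WithLp.toLp 2 (y - B *ᵥ z)‖ ≤ ν

/-- `z` solves (P1): it is feasible and has the least `ℓ₁` norm among all feasible vectors. -/
def IsP1Solution {n d : ℕ} (B : Matrix (Fin n) (Fin d) ℝ) (y : Fin n → ℝ) (ν : ℝ)
    (z : Fin d → ℝ) : Prop :=
  IsFeasible B y ν z ∧ ∀ w : Fin d → ℝ, IsFeasible B y ν w → ∑ j, |z j| ≤ ∑ j, |w j|

/-- A sparse recovery routine instantiated with (P1): it returns some solution of (P1) whenever
there is one (which one is left open), and an arbitrary vector otherwise. -/
def IsP1Solver {n d : ℕ} (ν : ℝ)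
    (rec : Matrix (Fin n) (Fin d) ℝ → (Fin n → ℝ) → (Fin d → ℝ)) : Prop :=
  ∀ B y, (∃ z, IsP1Solution B y ν z) → IsP1Solution B y ν (rec B y)

/-! ### Queries -/

/-- The queries made by the algorithm: for each of the `2m+1` grid points, each of the `n` sign
vectors and each sign (`1` for `x⁺`, `-1` for `x⁻`), the point is queried `N` times. -/
abbrev Query (m n N : ℕ) : Type := Fin (2 * m + 1) × Fin n × ℤˣ × Fin N

/-- The grid points `-1, -(m-1)/m, …, (m-1)/m, 1`. -/
def gridValue (m : ℕ) (g : Fin (2 * m + 1)) : ℝ := ((g : ℕ) - (m : ℝ)) / m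

/-- The diagonal point `(x, …, x)` with the coordinates `j` where `b j ≠ s` set to zero; this is
`x⁺` for `s = 1` and `x⁻` for `s = -1`. -/
def queryPoint {d : ℕ} (x : ℝ) (b : Fin d → ℤˣ) (s : ℤˣ) : Fin d → ℝ :=
  fun j => if b j = s then x else 0

/-- The noisy answers: each query returns the value of `f` plus its own noise sample. -/
def answers {d m n N : ℕ} (f : (Fin d → ℝ) → ℝ) (β : Fin n → Fin d → ℤˣ)
    (η : Query m n N → ℝ) : Query m n N → ℝ :=
  fun q => f (queryPoint (gridValue m q.1) (β q.2.1) q.2.2.1) + η q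

/-! ### The algorithm -/

/-- The matrix with rows `β₁, …, βₙ`. -/
def signMatrix {n d : ℕ} (β : Fin n → Fin d → ℤˣ) : Matrix (Fin n) (Fin d) ℝ :=
  Matrix.of fun i j => ((β i j : ℤ) : ℝ)

/-- The average of the `N` answers obtained at one and the same point. -/
def average {m n N : ℕ} (a : Query m n N → ℝ) (g : Fin (2 * m + 1)) (i : Fin n) (s : ℤˣ) : ℝ :=
  (∑ r : Fin N, a (g, i, s, r)) / N

/-- The measurement vector at a grid point: averaged value at `x⁺ᵢ` minus that at `x⁻ᵢ`. -/
def measurements {m n N : ℕ} (a : Query m n N → ℝ) (g : Fin (2 * m + 1)) : Fin n → ℝ :=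
  fun i => average a g i 1 - average a g i (-1)

/-- The output of the algorithm, given the sign vectors `β` and the answers `a` to its queries:
the union over the grid of the sets of coordinates whose estimate exceeds the threshold `τ`. -/
def estimatedSupport {d m n N : ℕ} (τ : ℝ)
    (rec : Matrix (Fin n) (Fin d) ℝ → (Fin n → ℝ) → (Fin d → ℝ))
    (β : Fin n → Fin d → ℤˣ) (a : Query m n N → ℝ) : Finset (Fin d) :=
  Finset.univ.biUnion fun g : Fin (2 * m + 1) =>
    Finset.univ.filter fun p => τ < |rec (signMatrix β) (measurements a g) p|

/-! ### Randomness -/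

/-- The law of a Rademacher variable. -/
def rademacher : Measure ℤˣ := (PMF.uniformOfFintype ℤˣ).toMeasure

/-- The law of a run: independent Rademacher signs `β`, and, independently of them, i.i.d.
noise samples with law `N(0, σ²)`, one for every query. -/
def runLaw (d m n N : ℕ) (σ : ℝ) : Measure ((Fin n → Fin d → ℤˣ) × (Query m n N → ℝ)) :=
  (Measure.pi fun _ : Fin n => Measure.pi fun _ : Fin d => rademacher).prod
    (Measure.pi fun _ : Query m n N => gaussianReal 0 (σ ^ 2).toNNReal)

end Spam

end

/-! Since $\phi_p(0)=0$, subtracting the values of $f$ at $\mathbf x_i^+$ and $\mathbf x_i^-$ leaves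
$\sum_{p\in S}\beta_{i,p}\phi_p(x)$. Each grid point thus gives noisy linear measurements
$y=Bz+\text{noise}$ of the vector $z$ with entries $\phi_p(x)$, supported on $S$. Two independent
events suffice.

First, $\|Bh\|_2^2\ge\frac n2\|h\|_2^2$ on the cone $\|h\|_1\le2\|h_S\|_1$ (`signLaw_coneBound`). A
lower-tail bound for one fixed vector (`signLaw_lower_tail`) and a union bound cover the finitely
many sums of $4|S|+1$ vectors $\pm e_j$; Maurey's empirical method (`LowerIsometry.le_add`) carries
the bound to all vectors at the cost of an $\ell_1$ term, which the cone absorbs. Only this lower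
bound on $B$ is needed, not a two-sided isometry.

Second, the noise has norm at most $\nu$ at every grid point (`noiseLaw_smallNoise`), by a Gaussian
chi-square tail and a union bound over the grid.

On both events $z$ is feasible and (P1) errs by at most $3\nu/\sqrt n=\epsilon<D/3$ in each
coordinate. Off $S$ no estimate exceeds the threshold; for $p\in S$ some grid point has
$|\phi_p|>2D/3$, so its estimate does (`estimatedSupport_eq`). -/

namespace Spam

/-! ### Maurey's empirical method -/

section Maurey

variable {V ι : Type*} [AddCommGroup V] [Module ℝ V] [Fintype ι]

/-- Empirical averages: if a quadratic form is nonnegative on all sums of `s` vectors from a family,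
it is nonnegative on average over `s` independent draws from any distribution on the family. -/
theorem quadratic_average_nonneg (b : LinearMap.BilinForm ℝ V) (hb : b.IsSymm) (u : ι → V)
    (p : ι → ℝ) (hp : ∀ j, 0 ≤ p j) (hp1 : ∑ j, p j = 1) (s : ℕ) (a : V)
    (h : ∀ m : Multiset ι, m.card = s → 0 ≤ b (a + (m.map u).sum) (a + (m.map u).sum)) :
    0 ≤ b a a + 2 * s * b a (∑ j, p j • u j) + s * ∑ j, p j * b (u j) (u j) +
      s * (s - 1) * b (∑ j, p j • u j) (∑ j, p j • u j) := by
  -- One draw is peeled off and absorbed into the base point, so `a` must vary; averaging over that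
  -- draw with weights `p` closes the step.
  induction s generalizing a with
  | zero => simpa using h 0 rfl
  | succ r ih =>
    set x := ∑ j, p j • u j with hx
    have key : ∀ j, 0 ≤ p j * (b (a + u j) (a + u j) + 2 * r * b (a + u j) x +
        r * ∑ j, p j * b (u j) (u j) + r * (r - 1) * b x x) := by
      intro j
      refine mul_nonneg (hp j) (ih (a + u j) fun m hm => ?_)
      have := h (j ::ₘ m) (by simp [hm])
      simpa [add_assoc] using this
    have hsum := Finset.sum_nonneg fun j (_ : j ∈ Finset.univ) => key j
    have hlin : ∀ v : V, ∑ j, p j * b v (u j) = b v x := by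
      intro v; simp [hx, map_sum]
    have hlin' : ∑ j, p j * b (u j) x = b x x := by
      have : ∀ v : V, ∑ j, p j * b (u j) v = b x v := by
        intro v; simp [hx, LinearMap.sum_apply]
      exact this x
    have e : ∀ j, p j * (b (a + u j) (a + u j) + 2 * r * b (a + u j) x +
        r * ∑ j, p j * b (u j) (u j) + r * (r - 1) * b x x) =
        p j * (b a a + 2 * r * b a x + r * ∑ j, p j * b (u j) (u j) + r * (r - 1) * b x x) +
        2 * (p j * b a (u j)) + p j * b (u j) (u j) + 2 * r * (p j * b (u j) x) := by
      intro j
      have : b (u j) a = b a (u j) := hb.eq _ _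
      simp only [map_add, LinearMap.add_apply, this]
      ring
    simp only [e, Finset.sum_add_distrib, ← Finset.sum_mul, ← Finset.mul_sum, hp1, hlin,
      hlin'] at hsum
    push_cast
    linarith

end Maurey

/-- The vector `±e_j`. -/
def signedBasis {d : ℕ} (q : Fin d × ℤˣ) : Fin d → ℝ := Pi.single q.1 ((q.2 : ℤ) : ℝ)

theorem sum_signedBasis_sq {d : ℕ} (q : Fin d × ℤˣ) : ∑ j, signedBasis q j ^ 2 = 1 := by
  rw [Finset.sum_eq_single q.1]
  · rcases Int.units_eq_one_or q.2 with h | h <;> simp [signedBasis, h]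
  · intro j _ hj; simp [signedBasis, hj]
  · simp

/-- The $\ell_1$ ball is the convex hull of the $\pm e_j$; the weights are the normalized positive
and negative parts of the entries. -/
theorem exists_sum_signedBasis {d : ℕ} (x : Fin d → ℝ) (hx : x ≠ 0) :
    ∃ p : Fin d × ℤˣ → ℝ, (∀ q, 0 ≤ p q) ∧ ∑ q, p q = 1 ∧
      ∑ q, p q • signedBasis q = (∑ j, |x j|)⁻¹ • x := by
  have hpos : 0 < ∑ j, |x j| := by
    obtain ⟨j, hj⟩ := Function.ne_iff.mp hx
    exact Finset.sum_pos' (fun _ _ => abs_nonneg _) ⟨j, Finset.mem_univ _, abs_pos.mpr hj⟩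
  have huniv : (Finset.univ : Finset ℤˣ) = {1, -1} := rfl
  have hne : (1 : ℤˣ) ≠ -1 := by decide
  refine ⟨fun q => (∑ j, |x j|)⁻¹ * if q.2 = 1 then (x q.1)⁺ else (x q.1)⁻, ?_, ?_, ?_⟩
  · intro q
    refine mul_nonneg (inv_nonneg.mpr hpos.le) ?_
    split_ifs
    exacts [posPart_nonneg _, negPart_nonneg _]
  · rw [← Finset.mul_sum, Fintype.sum_prod_type]
    simp only [huniv, Finset.sum_pair hne, if_true, if_neg hne.symm, posPart_add_negPart]
    exact inv_mul_cancel₀ hpos.ne'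
  · rw [Fintype.sum_prod_type]
    simp only [huniv, Finset.sum_pair hne, if_true, if_neg hne.symm]
    ext i
    simp only [Finset.sum_apply, Pi.add_apply, Pi.smul_apply, smul_eq_mul, signedBasis]
    rw [Finset.sum_eq_single i]
    · have := posPart_sub_negPart (x i)
      simp only [Pi.single_eq_same, Units.val_one, Units.val_neg, Int.cast_one, Int.cast_neg]
      rw [← this]; ring_nf; simp
    · intro j _ hj; simp [hj.symm]
    · simp

/-! ### Restricted eigenvalues and stable $\ell_1$ recovery -/

section Recovery

variable {n d : ℕ}

/-- The bilinear form of `‖B z‖² - c ‖z‖²`. -/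
def gapForm (B : Matrix (Fin n) (Fin d) ℝ) (c : ℝ) : LinearMap.BilinForm ℝ (Fin d → ℝ) :=
  LinearMap.mk₂ ℝ (fun z w => (B *ᵥ z) ⬝ᵥ (B *ᵥ w) - c * (z ⬝ᵥ w))
    (by intros; simp [Matrix.mulVec_add, add_dotProduct]; ring)
    (by intros; simp [Matrix.mulVec_smul]; ring)
    (by intros; simp [Matrix.mulVec_add, dotProduct_add]; ring)
    (by intros; simp [Matrix.mulVec_smul]; ring)

theorem gapForm_apply_self (B : Matrix (Fin n) (Fin d) ℝ) (c : ℝ) (z : Fin d → ℝ) :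
    gapForm B c z z = ∑ i, (B *ᵥ z) i ^ 2 - c * ∑ j, z j ^ 2 := by
  simp [gapForm, dotProduct, sq]

theorem gapForm_isSymm (B : Matrix (Fin n) (Fin d) ℝ) (c : ℝ) : (gapForm B c).IsSymm :=
  ⟨fun z w => by simp [gapForm, dotProduct_comm]⟩

/-- `B` is bounded below by `√(3n/4)` on all sums of `s` signed basis vectors. -/
def LowerIsometry (B : Matrix (Fin n) (Fin d) ℝ) (s : ℕ) : Prop :=
  ∀ m : Sym (Fin d × ℤˣ) s,
    3 / 4 * n * ∑ j : Fin d, ((m : Multiset (Fin d × ℤˣ)).map signedBasis).sum j ^ 2 ≤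
      ∑ i, (B *ᵥ ((m : Multiset (Fin d × ℤˣ)).map signedBasis).sum) i ^ 2

theorem signMatrix_signedBasis_sq (β : Fin n → Fin d → ℤˣ) (q : Fin d × ℤˣ) :
    ∑ i, (signMatrix β *ᵥ signedBasis q) i ^ 2 = n := by
  have : ∀ i, (signMatrix β *ᵥ signedBasis q) i ^ 2 = 1 := by
    intro i
    rw [signedBasis, Matrix.mulVec_single]
    rcases Int.units_eq_one_or q.2 with h | h <;>
      rcases Int.units_eq_one_or (β i q.1) with h' | h' <;> simp [signMatrix, h, h']
  simp [this]

/-- Lower isometry on sparse integer vectors transfers to all vectors, up to an `ℓ₁` error. -/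
theorem LowerIsometry.le_add {β : Fin n → Fin d → ℤˣ} {r : ℕ}
    (h : LowerIsometry (signMatrix β) (r + 1)) (x : Fin d → ℝ) :
    r * (3 / 4 * n * ∑ j, x j ^ 2) ≤
      r * ∑ i, (signMatrix β *ᵥ x) i ^ 2 + n / 4 * (∑ j, |x j|) ^ 2 := by
  rcases eq_or_ne x 0 with rfl | hx
  · simp
  obtain ⟨p, hp0, hp1, hpx⟩ := exists_sum_signedBasis x hx
  have hpos : 0 < ∑ j, |x j| := by
    obtain ⟨j, hj⟩ := Function.ne_iff.mp hx
    exact Finset.sum_pos' (fun _ _ => abs_nonneg _) ⟨j, Finset.mem_univ _, abs_pos.mpr hj⟩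
  -- From base point $0$ only the diagonal terms, each $n-\frac34n=\frac n4$, and the $(r+1)r$ cross
  -- terms survive. Dividing by $r+1$ and multiplying by $\|x\|_1^2$ gives the claim.
  have key := quadratic_average_nonneg (gapForm (signMatrix β) (3 / 4 * n)) (gapForm_isSymm _ _)
    signedBasis p hp0 hp1 (r + 1) 0 (fun m hm => by
      rw [zero_add, gapForm_apply_self, sub_nonneg]
      exact h ⟨m, hm⟩)
  have hq : ∀ q : Fin d × ℤˣ,
      gapForm (signMatrix β) (3 / 4 * n) (signedBasis q) (signedBasis q) = n / 4 := by
    intro q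
    rw [gapForm_apply_self, signMatrix_signedBasis_sq, sum_signedBasis_sq]; ring
  simp only [hq, hpx, map_smul, LinearMap.smul_apply, ← Finset.sum_mul, hp1, map_zero,
    LinearMap.zero_apply, gapForm_apply_self, smul_eq_mul] at key
  set t := ∑ j, |x j|
  have hr : (0 : ℝ) < r + 1 := by positivity
  have h2 : 0 ≤ (r + 1 : ℝ) * (n / 4 + r * (t⁻¹ * (t⁻¹ *
      (∑ i, (signMatrix β *ᵥ x) i ^ 2 - 3 / 4 * n * ∑ j, x j ^ 2)))) := by
    push_cast at key; linarith
  have h3 := mul_nonneg (sq_nonneg t) (nonneg_of_mul_nonneg_right h2 hr)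
  have h4 : t ^ 2 * (n / 4 + r * (t⁻¹ * (t⁻¹ *
      (∑ i, (signMatrix β *ᵥ x) i ^ 2 - 3 / 4 * n * ∑ j, x j ^ 2)))) = n / 4 * t ^ 2 + r *
      (∑ i, (signMatrix β *ᵥ x) i ^ 2 - 3 / 4 * n * ∑ j, x j ^ 2) := by
    field_simp
  linarith

/-- Restricted eigenvalue property on the cone attached to `S`. -/
def ConeBound (B : Matrix (Fin n) (Fin d) ℝ) (S : Finset (Fin d)) : Prop :=
  ∀ h : Fin d → ℝ, ∑ j, |h j| ≤ 2 * ∑ j ∈ S, |h j| →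
    n / 2 * ∑ j, h j ^ 2 ≤ ∑ i, (B *ᵥ h) i ^ 2

/-- On the cone $\|x\|_1^2\le4|S|\,\|x\|_2^2$, so with $r=4|S|$ the $\ell_1$ error costs $\frac
n4\|x\|_2^2$ and $\frac34-\frac14=\frac12$ remains. -/
theorem LowerIsometry.coneBound {β : Fin n → Fin d → ℤˣ} {S : Finset (Fin d)}
    (hS : S.Nonempty) (h : LowerIsometry (signMatrix β) (4 * S.card + 1)) :
    ConeBound (signMatrix β) S := by
  intro x hx
  have h1 := h.le_add x
  have hk : (0 : ℝ) < S.card := by exact_mod_cast hS.card_pos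
  have h2 : (∑ j ∈ S, |x j|) ^ 2 ≤ S.card * ∑ j, x j ^ 2 := by
    calc (∑ j ∈ S, |x j|) ^ 2 ≤ S.card * ∑ j ∈ S, |x j| ^ 2 := sq_sum_le_card_mul_sum_sq
      _ ≤ S.card * ∑ j, x j ^ 2 := by
        simp only [sq_abs]
        gcongr
        exact Finset.subset_univ S
  have h3 : (∑ j, |x j|) ^ 2 ≤ (2 * ∑ j ∈ S, |x j|) ^ 2 :=
    pow_le_pow_left₀ (Finset.sum_nonneg fun j _ => abs_nonneg (x j)) hx 2
  have h4 : (∑ j, |x j|) ^ 2 ≤ 4 * (S.card * ∑ j, x j ^ 2) := by linarith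
  have h5 : (n : ℝ) / 4 * (∑ j, |x j|) ^ 2 ≤ n / 4 * (4 * (S.card * ∑ j, x j ^ 2)) := by gcongr
  push_cast at h1
  have h6 : (4 * (S.card : ℝ)) * (n / 2 * ∑ j, x j ^ 2) ≤
      (4 * S.card) * ∑ i, (signMatrix β *ᵥ x) i ^ 2 := by linarith
  exact le_of_mul_le_mul_left h6 (by positivity)

theorem coneBound_empty (B : Matrix (Fin n) (Fin d) ℝ) : ConeBound B ∅ := by
  intro h hh
  have : ∀ j, h j = 0 := by
    intro j
    have h0 : ∑ j, |h j| = 0 :=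
      le_antisymm (by simpa using hh) (Finset.sum_nonneg fun _ _ => abs_nonneg _)
    exact abs_eq_zero.mp
      ((Finset.sum_eq_zero_iff_of_nonneg fun _ _ => abs_nonneg _).mp h0 j (Finset.mem_univ _))
  simp only [this, ne_eq, OfNat.ofNat_ne_zero, not_false_eq_true, zero_pow,
    Finset.sum_const_zero, mul_zero]
  exact Finset.sum_nonneg fun _ _ => sq_nonneg _

theorem continuous_residual (B : Matrix (Fin n) (Fin d) ℝ) (y : Fin n → ℝ) :
    Continuous fun z : Fin d → ℝ => ‖WithLp.toLp 2 (y - B *ᵥ z)‖ := by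
  refine continuous_norm.comp ((PiLp.continuous_toLp 2 _).comp ?_)
  exact continuous_const.sub (Continuous.matrix_mulVec continuous_const continuous_id)

/-- `IsP1Solver` promises something only if a minimizer exists; compactness supplies one as soon as
(P1) is feasible. -/
theorem exists_isP1Solution {B : Matrix (Fin n) (Fin d) ℝ} {y : Fin n → ℝ} {ν : ℝ}
    {z : Fin d → ℝ} (hz : IsFeasible B y ν z) : ∃ w, IsP1Solution B y ν w := by
  have hc : Continuous fun w : Fin d → ℝ => ∑ j, |w j| := by fun_prop
  set K : Set (Fin d → ℝ) := {w | ‖WithLp.toLp 2 (y - B *ᵥ w)‖ ≤ ν} ∩ {w | ∑ j, |w j| ≤ ∑ j, |z j|}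
  have hK : IsCompact K := by
    refine Metric.isCompact_of_isClosed_isBounded
      ((isClosed_le (continuous_residual B y) continuous_const).inter
        (isClosed_le hc continuous_const)) ?_
    refine (Metric.isBounded_closedBall (x := (0 : Fin d → ℝ)) (r := ∑ j, |z j|)).subset ?_
    intro w hw
    rw [mem_closedBall_zero_iff,
      pi_norm_le_iff_of_nonneg (Finset.sum_nonneg fun _ _ => abs_nonneg _)]
    intro j
    exact (Finset.single_le_sum (f := fun j => |w j|) (fun _ _ => abs_nonneg _)
      (Finset.mem_univ j)).trans hw.2
  obtain ⟨w, hw, hmin⟩ := hK.exists_isMinOn ⟨z, hz, le_refl (∑ j, |z j|)⟩ hc.continuousOn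
  refine ⟨w, hw.1, fun v hv => ?_⟩
  rcases le_total (∑ j, |v j|) (∑ j, |z j|) with h | h
  · exact hmin ⟨hv, h⟩
  · exact le_trans hw.2 h

/-- Mass of $w$ off $S$ must be paid for by a loss on $S$, which is at most $\|(w-z)_S\|_1$. -/
theorem l1_cone {S : Finset (Fin d)} {z w : Fin d → ℝ} (hz : ∀ j ∉ S, z j = 0)
    (h : ∑ j, |w j| ≤ ∑ j, |z j|) : ∑ j, |(w - z) j| ≤ 2 * ∑ j ∈ S, |(w - z) j| := by
  have hk : ∀ j, |(w - z) j| ≤ |w j| - |z j| + 2 * if j ∈ S then |(w - z) j| else 0 := by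
    intro j
    by_cases hj : j ∈ S
    · simp only [hj, if_true, Pi.sub_apply]
      have := abs_sub_abs_le_abs_sub (z j) (w j)
      rw [abs_sub_comm (z j)] at this
      linarith
    · simp [hj, hz j hj]
  have := Finset.sum_le_sum fun j (_ : j ∈ Finset.univ) => hk j
  rw [Finset.sum_add_distrib, Finset.sum_sub_distrib, ← Finset.mul_sum, Finset.sum_ite_mem,
    Finset.univ_inter] at this
  linarith

/-- Stable recovery by (P1). -/
theorem ConeBound.abs_sub_le {B : Matrix (Fin n) (Fin d) ℝ} {S : Finset (Fin d)}
    (hB : ConeBound B S) (hn : 0 < n) {y : Fin n → ℝ} {ν : ℝ} {z w : Fin d → ℝ}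
    (hz : ∀ j ∉ S, z j = 0) (hzf : IsFeasible B y ν z) (hw : IsP1Solution B y ν w) (j : Fin d) :
    |w j - z j| ≤ 3 * ν / √n := by
  have hν : 0 ≤ ν := (norm_nonneg _).trans hzf
  have h1 := hB (w - z) (l1_cone hz (hw.2 z hzf))
  have h2 : ‖WithLp.toLp 2 (B *ᵥ (w - z))‖ ≤ 2 * ν := by
    have e : WithLp.toLp 2 (B *ᵥ (w - z)) =
        WithLp.toLp 2 (y - B *ᵥ z) - WithLp.toLp 2 (y - B *ᵥ w) := by
      rw [← WithLp.toLp_sub, Matrix.mulVec_sub]; congr 1; abel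
    rw [e]
    refine (norm_sub_le _ _).trans ?_
    have a : ‖WithLp.toLp 2 (y - B *ᵥ z)‖ ≤ ν := hzf
    have b : ‖WithLp.toLp 2 (y - B *ᵥ w)‖ ≤ ν := hw.1
    linarith
  have h3 : ∑ i, (B *ᵥ (w - z)) i ^ 2 ≤ (2 * ν) ^ 2 := by
    have := pow_le_pow_left₀ (norm_nonneg _) h2 2
    rwa [EuclideanSpace.real_norm_sq_eq] at this
  have h4 : (w j - z j) ^ 2 ≤ ∑ j, (w - z) j ^ 2 :=
    Finset.single_le_sum (f := fun j => (w - z) j ^ 2) (fun _ _ => sq_nonneg _)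
      (Finset.mem_univ j)
  have hn' : (0 : ℝ) < n := by exact_mod_cast hn
  refine abs_le_of_sq_le_sq ?_ (by positivity)
  rw [div_pow, Real.sq_sqrt hn'.le, le_div_iff₀ hn']
  have h5 : (n : ℝ) / 2 * (w j - z j) ^ 2 ≤ n / 2 * ∑ j, (w - z) j ^ 2 := by gcongr
  -- The cone bound gives $n(w_j-z_j)^2\le8\nu^2$, and $8\le3^2$.
  nlinarith [sq_nonneg ν]

end Recovery

/-! ### Lower tail for random sign matrices -/

instance : MeasurableSingletonClass ℤˣ where
  measurableSet_singleton u := by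
    have : ({u} : Set ℤˣ) = Units.val ⁻¹' {(u : ℤ)} := by
      ext x; simp [Units.ext_iff]
    rw [this]
    exact comap_measurable _ (measurableSet_singleton _)

instance : IsProbabilityMeasure rademacher := by
  unfold rademacher; infer_instance

theorem integral_rademacher : ∫ s : ℤˣ, ((s : ℤ) : ℝ) ∂rademacher = 0 := by
  rw [rademacher, PMF.integral_eq_sum]
  have huniv : (Finset.univ : Finset ℤˣ) = {1, -1} := rfl
  have hne : (1 : ℤˣ) ≠ -1 := by decide
  simp [huniv, Finset.sum_pair hne]

/-- Adding one sign at a time, the odd powers of the new sign integrate to zero by independence; the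
fourth moment then closes via $w^4+6w^2V+3V^2\le3(w^2+V)^2$. -/
theorem rademacher_moments {ι : Type*} [Fintype ι] [DecidableEq ι] (w : ι → ℝ) (T : Finset ι) :
    ∫ b : ι → ℤˣ, (∑ j ∈ T, w j * ((b j : ℤ) : ℝ)) ^ 2 ∂(Measure.pi fun _ => rademacher) =
      ∑ j ∈ T, w j ^ 2 ∧
    ∫ b : ι → ℤˣ, (∑ j ∈ T, w j * ((b j : ℤ) : ℝ)) ^ 4 ∂(Measure.pi fun _ => rademacher) ≤
      3 * (∑ j ∈ T, w j ^ 2) ^ 2 := by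
  set μ : Measure (ι → ℤˣ) := Measure.pi fun _ => rademacher
  have hint : ∀ F : (ι → ℤˣ) → ℝ, Integrable F μ := fun F => Integrable.of_finite
  set f : ι → (ι → ℤˣ) → ℝ := fun j b => w j * ((b j : ℤ) : ℝ) with hf
  have hfm : ∀ j, Measurable (f j) := fun j => measurable_of_finite _
  have hind : iIndepFun f μ :=
    iIndepFun_pi (X := fun j (s : ℤˣ) => w j * ((s : ℤ) : ℝ)) fun j =>
      (measurable_of_finite _).aemeasurable
  have hmean : ∀ j, ∫ b, f j b ∂μ = 0 := by
    intro j
    have := integral_comp_eval (μ := fun _ : ι => rademacher) (i := j)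
      (f := fun s : ℤˣ => w j * ((s : ℤ) : ℝ)) (measurable_of_finite _).aestronglyMeasurable
    exact this.trans (by rw [integral_const_mul, integral_rademacher, mul_zero])
  have hsq : ∀ j b, f j b ^ 2 = w j ^ 2 := by
    intro j b
    rcases Int.units_eq_one_or (b j) with h | h <;> simp [hf, h]
  induction T using Finset.induction_on with
  | empty => simp
  | insert a T ha ih =>
    set X : (ι → ℤˣ) → ℝ := fun b => ∑ j ∈ T, f j b with hX
    have hXf : (∑ j ∈ T, f j) = X := by ext b; simp [hX]
    have hodd : ∀ k : ℕ, ∫ b, X b ^ k * f a b ∂μ = 0 := by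
      intro k
      have h1 := hind.indepFun_finsetSum_of_notMem hfm ha
      rw [hXf] at h1
      have h2 := h1.comp (φ := fun x : ℝ => x ^ k) (ψ := id) (by fun_prop) measurable_id
      have h3 := h2.integral_fun_mul_eq_mul_integral (hint _).aestronglyMeasurable
        (hint _).aestronglyMeasurable
      simpa [Function.comp_def, hmean] using h3
    have h2 : ∀ b, (∑ j ∈ insert a T, f j b) ^ 2 =
        w a ^ 2 + 2 * (X b ^ 1 * f a b) + X b ^ 2 := by
      intro b
      rw [Finset.sum_insert ha, ← hsq a b]; ring
    have h4 : ∀ b, (∑ j ∈ insert a T, f j b) ^ 4 =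
        w a ^ 4 + 4 * w a ^ 2 * (X b ^ 1 * f a b) + 6 * w a ^ 2 * X b ^ 2 +
          4 * (X b ^ 3 * f a b) + X b ^ 4 := by
      intro b
      have e4 : w a ^ 4 = (f a b ^ 2) ^ 2 := by rw [hsq]; ring
      rw [Finset.sum_insert ha, e4, ← hsq a b]; ring
    have i2 : ∫ b, (∑ j ∈ insert a T, f j b) ^ 2 ∂μ = w a ^ 2 + ∫ b, X b ^ 2 ∂μ := by
      simp only [h2]
      rw [integral_add (hint _) (hint _), integral_add (hint _) (hint _), integral_const_mul,
        hodd]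
      simp
    have i4 : ∫ b, (∑ j ∈ insert a T, f j b) ^ 4 ∂μ =
        w a ^ 4 + 6 * w a ^ 2 * ∫ b, X b ^ 2 ∂μ + ∫ b, X b ^ 4 ∂μ := by
      simp only [h4]
      rw [integral_add (hint _) (hint _), integral_add (hint _) (hint _),
        integral_add (hint _) (hint _), integral_add (hint _) (hint _), integral_const_mul,
        integral_const_mul, integral_const_mul, hodd, hodd]
      simp
    obtain ⟨ih2, ih4⟩ := ih
    rw [i2, i4, ih2, Finset.sum_insert ha]
    refine ⟨rfl, ?_⟩
    nlinarith [sq_nonneg (w a ^ 2)]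

theorem exp_neg_le_quadratic {y : ℝ} (hy : 0 ≤ y) : Real.exp (-y) ≤ 1 - y + y ^ 2 / 2 := by
  have h1 := Real.quadratic_le_exp_of_nonneg hy
  have h2 : 0 < 1 - y + y ^ 2 / 2 := by nlinarith [sq_nonneg (y - 1)]
  rw [Real.exp_neg, inv_le_comm₀ (Real.exp_pos y) h2, inv_le_iff_one_le_mul₀ h2]
  -- Uses $(1-y+y^2/2)(1+y+y^2/2)=1+y^4/4\ge1$.
  nlinarith [mul_le_mul_of_nonneg_left h1 h2.le, sq_nonneg (y ^ 2)]

/-- The parameter $\lambda=\frac1{12}$ maximizes the resulting Chernoff exponent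
$\lambda-\frac32\lambda^2-\frac34\lambda$ at level $\frac34$; the maximum is $\frac1{96}$. -/
theorem integral_exp_neg_rademacher_sq_le {d : ℕ} (z : Fin d → ℝ) (hz : 0 < ∑ j, z j ^ 2) :
    ∫ b : Fin d → ℤˣ, Real.exp (-(1 / 12 * ((∑ j, z j * ((b j : ℤ) : ℝ)) ^ 2 / ∑ j, z j ^ 2)))
      ∂(Measure.pi fun _ => rademacher) ≤ Real.exp (-(7 / 96)) := by
  set v := ∑ j, z j ^ 2
  obtain ⟨h2, h4⟩ := rademacher_moments z Finset.univ
  set μ : Measure (Fin d → ℤˣ) := Measure.pi fun _ => rademacher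
  have hint : ∀ F : (Fin d → ℤˣ) → ℝ, Integrable F μ := fun F => Integrable.of_finite
  set X : (Fin d → ℤˣ) → ℝ := fun b => ∑ j, z j * ((b j : ℤ) : ℝ)
  calc ∫ b, Real.exp (-(1 / 12 * (X b ^ 2 / v))) ∂μ
      ≤ ∫ b, (1 - 1 / (12 * v) * X b ^ 2 + 1 / (288 * v ^ 2) * X b ^ 4) ∂μ := by
        refine integral_mono (hint _) (hint _) fun b => ?_
        refine (exp_neg_le_quadratic (by positivity)).trans (le_of_eq ?_)
        field_simp; ring
    _ = 1 - 1 / (12 * v) * ∫ b, X b ^ 2 ∂μ + 1 / (288 * v ^ 2) * ∫ b, X b ^ 4 ∂μ := by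
        rw [integral_add (hint _) (hint _), integral_sub (hint _) (hint _), integral_const_mul,
          integral_const_mul]
        simp
    _ ≤ 1 - 1 / (12 * v) * v + 1 / (288 * v ^ 2) * (3 * v ^ 2) := by
        rw [h2]; gcongr
    _ = -(7 / 96) + 1 := by field_simp; norm_num
    _ ≤ Real.exp (-(7 / 96)) := Real.add_one_le_exp _

/-- The law of the sign vectors. -/
noncomputable abbrev signLaw (n d : ℕ) : Measure (Fin n → Fin d → ℤˣ) :=
  Measure.pi fun _ => Measure.pi fun _ => rademacher

theorem signLaw_lower_tail {n d : ℕ} (z : Fin d → ℝ) :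
    (signLaw n d).real {β | ∑ i, (signMatrix β *ᵥ z) i ^ 2 < 3 / 4 * n * ∑ j, z j ^ 2} ≤
      Real.exp (-(n / 96)) := by
  set v := ∑ j, z j ^ 2 with hv
  have hv0 : 0 ≤ v := Finset.sum_nonneg fun _ _ => sq_nonneg _
  rcases hv0.eq_or_lt with h0 | hpos
  · have : {β : Fin n → Fin d → ℤˣ | ∑ i, (signMatrix β *ᵥ z) i ^ 2 < 3 / 4 * n * v} = ∅ := by
      ext β
      simp only [← h0, mul_zero, Set.mem_ofPred_eq, Set.mem_empty_iff_false, iff_false, not_lt]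
      exact Finset.sum_nonneg fun _ _ => sq_nonneg _
    rw [this, measureReal_empty]
    positivity
  set g : (Fin d → ℤˣ) → ℝ := fun b =>
    Real.exp (-(1 / 12 * ((∑ j, z j * ((b j : ℤ) : ℝ)) ^ 2 / v))) with hg
  have hX : ∀ (β : Fin n → Fin d → ℤˣ) i,
      (signMatrix β *ᵥ z) i = ∑ j, z j * ((β i j : ℤ) : ℝ) := by
    intro β i
    simp [signMatrix, Matrix.mulVec, dotProduct, mul_comm]
  have hprod : ∀ β : Fin n → Fin d → ℤˣ,
      ∏ i, g (β i) = Real.exp (-(1 / 12 * ((∑ i, (signMatrix β *ᵥ z) i ^ 2) / v))) := by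
    intro β
    simp only [hg, ← Real.exp_sum, hX, Finset.sum_neg_distrib, ← Finset.mul_sum, Finset.sum_div]
  have hI : ∫ β, ∏ i, g (β i) ∂(signLaw n d) ≤ Real.exp (-(7 / 96)) ^ n := by
    rw [integral_fintype_prod_eq_pow, Fintype.card_fin]
    exact pow_le_pow_left₀ (integral_nonneg fun _ => (Real.exp_pos _).le)
      (integral_exp_neg_rademacher_sq_le z hpos) n
  have hM := mul_meas_ge_le_integral_of_nonneg (μ := signLaw n d) (f := fun β => ∏ i, g (β i))
    (Filter.Eventually.of_forall fun β => by
      simp only [hprod, Pi.zero_apply]; exact (Real.exp_pos _).le)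
    Integrable.of_finite (Real.exp (-(n / 16)))
  have hsub : (signLaw n d).real {β | ∑ i, (signMatrix β *ᵥ z) i ^ 2 < 3 / 4 * n * v} ≤
      (signLaw n d).real {β | Real.exp (-((n : ℝ) / 16)) ≤ ∏ i, g (β i)} := by
    refine measureReal_mono fun β hβ => ?_
    simp only [Set.mem_ofPred_eq] at hβ ⊢
    rw [hprod, Real.exp_le_exp]
    have : (∑ i, (signMatrix β *ᵥ z) i ^ 2) / v ≤ 3 / 4 * n := by
      rw [div_le_iff₀ hpos]; exact hβ.le
    linarith
  have h1 : Real.exp (-((n : ℝ) / 16)) *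
      (signLaw n d).real {β | ∑ i, (signMatrix β *ᵥ z) i ^ 2 < 3 / 4 * n * v} ≤
      Real.exp (-((n : ℝ) / 16)) * Real.exp (-(n / 96)) := by
    refine (mul_le_mul_of_nonneg_left hsub (Real.exp_pos _).le).trans (hM.trans (hI.trans ?_))
    rw [← Real.exp_nat_mul, ← Real.exp_add]
    exact Real.exp_le_exp.mpr (by linarith)
  exact le_of_mul_le_mul_left h1 (Real.exp_pos _)

/-- Multisets are counted by $\binom{2d+4k}{s}\le(6de/s)^s$ with $s=4k+1\le5k$, and $6e/s\le5/k$. -/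
theorem card_sym_signedBasis_le {d k : ℕ} (hk : 0 < k) (hkd : k ≤ d) :
    (Fintype.card (Sym (Fin d × ℤˣ) (4 * k + 1)) : ℝ) ≤
      Real.exp (5 * k * Real.log (5 * d / k)) := by
  have hd : 0 < d := hk.trans_le hkd
  have hk' : (0 : ℝ) < k := by exact_mod_cast hk
  have hkd' : (k : ℝ) ≤ d := by exact_mod_cast hkd
  have hd' : (0 : ℝ) < d := by exact_mod_cast hd
  set s := 4 * k + 1 with hs
  have hs' : (s : ℝ) = 4 * k + 1 := by rw [hs]; push_cast; ring
  have hspos : (0 : ℝ) < s := by rw [hs']; positivity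
  have hone : (1 : ℝ) ≤ 5 * d / k := by rw [le_div_iff₀ hk']; linarith
  have hcard : Fintype.card (Fin d × ℤˣ) + s - 1 = 2 * d + 4 * k := by
    simp [hs]; omega
  have hfac : (s : ℝ) ^ s / s.factorial ≤ Real.exp 1 ^ s := by
    rw [← Real.exp_nat_mul, mul_one]
    exact Real.pow_div_factorial_le_exp _ hspos.le s
  rw [Sym.card_sym_eq_choose, hcard]
  calc (((2 * d + 4 * k).choose s : ℕ) : ℝ)
      ≤ ((2 * d + 4 * k : ℕ) : ℝ) ^ s / s.factorial := Nat.choose_le_pow_div _ _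
    _ ≤ (6 * d) ^ s / s.factorial := by
        gcongr; push_cast; linarith
    _ = (6 * d / s) ^ s * ((s : ℝ) ^ s / s.factorial) := by
        rw [div_pow]; field_simp
    _ ≤ (6 * d / s) ^ s * Real.exp 1 ^ s := by gcongr
    _ = (6 * d / s * Real.exp 1) ^ s := by rw [mul_pow]
    _ ≤ (5 * d / k) ^ s := by
        have := Real.exp_one_lt_d9
        refine pow_le_pow_left₀ (by positivity) ?_ s
        rw [div_mul_eq_mul_div, div_le_div_iff₀ hspos hk', hs']
        have h1 : Real.exp 1 * (d * k) ≤ 2.75 * (d * k) :=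
          mul_le_mul_of_nonneg_right (by linarith) (by positivity)
        nlinarith [mul_pos hd' hk']
    _ ≤ (5 * d / k) ^ (5 * k) := pow_le_pow_right₀ hone (by omega)
    _ = Real.exp (5 * k * Real.log (5 * d / k)) := by
        rw [← Real.exp_log (x := 5 * d / k) (by positivity), ← Real.exp_nat_mul, Real.log_exp]
        push_cast; rfl

/-- As $960=5\cdot192$, the union bound consumes half of the exponent $n/96$. -/
theorem signLaw_lowerIsometry {n d k : ℕ} (hk : 0 < k) (hkd : k ≤ d)
    (hn : 960 * k * Real.log (5 * d / k) ≤ n) :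
    1 - Real.exp (-(1 / 192 * n)) ≤
      (signLaw n d).real {β | LowerIsometry (signMatrix β) (4 * k + 1)} := by
  set G := {β : Fin n → Fin d → ℤˣ | LowerIsometry (signMatrix β) (4 * k + 1)} with hG
  have hGm : MeasurableSet G := Set.Finite.measurableSet (Set.toFinite _)
  have hbad : (signLaw n d).real Gᶜ ≤ Real.exp (-(1 / 192 * n)) := by
    have hsub : Gᶜ ⊆ ⋃ m : Sym (Fin d × ℤˣ) (4 * k + 1), {β : Fin n → Fin d → ℤˣ |
        ∑ i, (signMatrix β *ᵥ ((m : Multiset (Fin d × ℤˣ)).map signedBasis).sum) i ^ 2 <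
          3 / 4 * n * ∑ j : Fin d, ((m : Multiset (Fin d × ℤˣ)).map signedBasis).sum j ^ 2} := by
      intro β hβ
      simpa [hG, LowerIsometry] using hβ
    calc (signLaw n d).real Gᶜ ≤ _ := measureReal_mono hsub
      _ ≤ _ := measureReal_iUnion_fintype_le _
      _ ≤ ∑ _m : Sym (Fin d × ℤˣ) (4 * k + 1), Real.exp (-(n / 96)) :=
          Finset.sum_le_sum fun m _ => signLaw_lower_tail _
      _ = Fintype.card (Sym (Fin d × ℤˣ) (4 * k + 1)) * Real.exp (-(n / 96)) := by
          simp
      _ ≤ Real.exp (5 * k * Real.log (5 * d / k)) * Real.exp (-(n / 96)) := by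
          gcongr; exact card_sym_signedBasis_le hk hkd
      _ ≤ Real.exp (-(1 / 192 * n)) := by
          rw [← Real.exp_add, Real.exp_le_exp]; linarith
  rw [probReal_compl_eq_one_sub hGm] at hbad
  linarith

/-! ### Chi-square tails for linear images of Gaussian noise -/

theorem gaussian_exp_sq {b : ℝ} (hb : b < 1 / 2) :
    Integrable (fun x : ℝ => Real.exp (b * x ^ 2)) (gaussianReal 0 1) ∧
      ∫ x, Real.exp (b * x ^ 2) ∂(gaussianReal 0 1) = (√(1 - 2 * b))⁻¹ := by
  have e : ∀ x : ℝ, gaussianPDFReal 0 1 x • Real.exp (b * x ^ 2) =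
      (√(2 * Real.pi))⁻¹ * Real.exp (-(1 / 2 - b) * x ^ 2) := by
    intro x
    simp only [gaussianPDFReal, NNReal.coe_one, mul_one, sub_zero, smul_eq_mul]
    rw [mul_assoc, ← Real.exp_add]
    congr 2; ring
  constructor
  · rw [gaussianReal_of_var_ne_zero 0 one_ne_zero, integrable_withDensity_iff_integrable_smul'
      (measurable_gaussianPDF 0 1) (Filter.Eventually.of_forall fun _ => gaussianPDF_lt_top)]
    simp only [toReal_gaussianPDF, e]
    exact (integrable_exp_neg_mul_sq (by linarith)).const_mul _
  · rw [integral_gaussianReal_eq_integral_smul one_ne_zero]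
    simp only [e]
    rw [integral_const_mul, integral_gaussian, ← Real.sqrt_inv, ← Real.sqrt_inv,
      ← Real.sqrt_mul (by positivity)]
    congr 1
    have h1 : (1 : ℝ) - 2 * b ≠ 0 := by linarith
    have h2 : (1 : ℝ) / 2 - b ≠ 0 := by linarith
    have := Real.pi_ne_zero
    field_simp

theorem inv_sqrt_one_sub_le {b : ℝ} (h0 : 0 ≤ b) (h1 : b ≤ 1 / 4) :
    (√(1 - 2 * b))⁻¹ ≤ Real.exp (b + 2 * b ^ 2) := by
  have hpos : 0 < 1 - 2 * b := by linarith
  rw [inv_le_iff_one_le_mul₀ (Real.sqrt_pos.mpr hpos)]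
  have hq := Real.quadratic_le_exp_of_nonneg (x := 2 * b + 4 * b ^ 2) (by positivity)
  have he : Real.exp (2 * b + 4 * b ^ 2) = Real.exp (b + 2 * b ^ 2) ^ 2 := by
    rw [← Real.exp_nat_mul]; congr 1; push_cast; ring
  have h2 : 1 ≤ (Real.exp (b + 2 * b ^ 2) * √(1 - 2 * b)) ^ 2 := by
    rw [mul_pow, Real.sq_sqrt hpos.le, ← he]
    have h3 := mul_le_mul_of_nonneg_right hq hpos.le
    have h4 : (1 : ℝ) ≤ (1 + (2 * b + 4 * b ^ 2) + (2 * b + 4 * b ^ 2) ^ 2 / 2) * (1 - 2 * b) := by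
      have h5 : 0 ≤ b ^ 2 * (2 - 4 * b - 8 * b ^ 2 - 16 * b ^ 3) := by
        refine mul_nonneg (sq_nonneg _) ?_
        have : b ^ 2 ≤ 1 / 16 := by nlinarith
        have : b ^ 3 ≤ 1 / 64 := by nlinarith
        linarith
      nlinarith
    linarith
  exact (one_le_sq_iff₀ (by positivity)).mp h2

/-- Linearization of the square: the exponential moment of the squared norm of the Gaussian vector
`A η` whose covariance is a multiple of the identity. -/
theorem integral_exp_sum_sq_gaussian {ι κ : Type*} [Fintype ι] [Fintype κ] (v : NNReal) (w : ℝ)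
    (a : ι → κ → ℝ) (ha : ∀ g : ι → ℝ, ∑ q, (∑ i, g i * a i q) ^ 2 = w * ∑ i, g i ^ 2)
    (t : ℝ) (ht : t ^ 2 * (v * w) < 1) :
    Integrable (fun η : κ → ℝ => Real.exp (t ^ 2 / 2 * ∑ i, (∑ q, a i q * η q) ^ 2))
      (Measure.pi fun _ => gaussianReal 0 v) ∧
    ∫ η : κ → ℝ, Real.exp (t ^ 2 / 2 * ∑ i, (∑ q, a i q * η q) ^ 2)
      ∂(Measure.pi fun _ => gaussianReal 0 v) =
      (√(1 - t ^ 2 * (v * w)))⁻¹ ^ Fintype.card ι := by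
  set μ : Measure (κ → ℝ) := Measure.pi fun _ => gaussianReal 0 v
  set γ : Measure (ι → ℝ) := Measure.pi fun _ => gaussianReal 0 1
  -- With $g$ standard Gaussian, $\mathbb E_g e^{t\langle g,A\eta\rangle}=e^{t^2\|A\eta\|^2/2}$.
  -- Integrating over $\eta$ first instead leaves a product over the coordinates of $g$, by `ha`.
  set F : (κ → ℝ) → (ι → ℝ) → ℝ := fun η g => Real.exp (∑ i, (t * ∑ q, a i q * η q) * g i) with hF
  have hswap : ∀ η g, F η g = ∏ q, Real.exp ((t * ∑ i, g i * a i q) * η q) := by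
    intro η g
    rw [← Real.exp_sum]
    simp only [hF, Finset.mul_sum, Finset.sum_mul]
    rw [Finset.sum_comm]
    congr 1
    refine Finset.sum_congr rfl fun q _ => Finset.sum_congr rfl fun i _ => by ring
  have hmgf : ∀ (u : NNReal) (c : ℝ), ∫ x, Real.exp (c * x) ∂(gaussianReal 0 u) =
      Real.exp (u * c ^ 2 / 2) := by
    intro u c
    have := congrFun (mgf_id_gaussianReal (μ := 0) (v := u)) c
    simpa [mgf] using this
  have hη : ∀ η, ∫ g, F η g ∂γ = Real.exp (t ^ 2 / 2 * ∑ i, (∑ q, a i q * η q) ^ 2) := by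
    intro η
    simp only [hF, Real.exp_sum]
    rw [integral_fintype_prod_eq_prod (f := fun i x => Real.exp ((t * ∑ q, a i q * η q) * x))]
    simp only [hmgf, ← Real.exp_sum, Finset.mul_sum]
    congr 1
    refine Finset.sum_congr rfl fun i _ => ?_
    rw [NNReal.coe_one, ← Finset.mul_sum]; ring
  set b : ℝ := t ^ 2 * (v * w) / 2 with hb
  have hg : ∀ g, ∫ η, F η g ∂μ = ∏ i, Real.exp (b * g i ^ 2) := by
    intro g
    simp only [hswap]
    rw [integral_fintype_prod_eq_prod (f := fun q x => Real.exp ((t * ∑ i, g i * a i q) * x))]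
    simp only [hmgf, ← Real.exp_sum]
    congr 1
    rw [← Finset.mul_sum]
    calc ∑ q, (v : ℝ) * (t * ∑ i, g i * a i q) ^ 2 / 2
        = v * t ^ 2 / 2 * ∑ q, (∑ i, g i * a i q) ^ 2 := by
          rw [Finset.mul_sum]; exact Finset.sum_congr rfl fun q _ => by ring
      _ = _ := by rw [ha, hb]; ring
  obtain ⟨hgi, hgv⟩ := gaussian_exp_sq (b := b) (by rw [hb]; linarith)
  have hcont : Continuous (Function.uncurry F) := by
    simp only [Function.uncurry_def, hF]; fun_prop
  have hInt : Integrable (Function.uncurry F) (μ.prod γ) := by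
    rw [integrable_prod_iff' hcont.aestronglyMeasurable]
    constructor
    · refine Filter.Eventually.of_forall fun g => ?_
      simp only [Function.uncurry_apply_pair, hswap]
      exact Integrable.fintype_prod
        (f := fun q x => Real.exp ((t * ∑ i, g i * a i q) * x))
        fun q => integrable_exp_mul_gaussianReal _
    · have : ∀ g η, ‖Function.uncurry F (η, g)‖ = F η g := fun g η => by
        simp [hF]
      simp only [this, hg]
      exact Integrable.fintype_prod (f := fun _ x => Real.exp (b * x ^ 2)) fun _ => hgi
  constructor
  · have := hInt.integral_prod_left
    simpa only [Function.uncurry_apply_pair, hη] using this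
  · calc ∫ η, Real.exp (t ^ 2 / 2 * ∑ i, (∑ q, a i q * η q) ^ 2) ∂μ
        = ∫ η, ∫ g, F η g ∂γ ∂μ := by simp only [hη]
      _ = ∫ g, ∫ η, F η g ∂μ ∂γ := integral_integral_swap hInt
      _ = _ := by
        simp only [hg]
        rw [integral_fintype_prod_eq_pow (f := fun x => Real.exp (b * x ^ 2)), hgv]
        congr 4
        rw [hb]; ring

/-- Upper tail of a Gaussian vector with covariance `(v w) I`. -/
theorem gaussian_sum_sq_tail {ι κ : Type*} [Fintype ι] [Fintype κ] (v : NNReal) (w : ℝ)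
    (hw : 0 < w) (a : ι → κ → ℝ)
    (ha : ∀ g : ι → ℝ, ∑ q, (∑ i, g i * a i q) ^ 2 = w * ∑ i, g i ^ 2) {ε : ℝ} (h0 : 0 < ε)
    (h1 : ε < 1) :
    (Measure.pi fun _ : κ => gaussianReal 0 v).real
      {η | (1 + ε) ^ 2 * (v * w) * Fintype.card ι < ∑ i, (∑ q, a i q * η q) ^ 2} ≤
      Real.exp (-(3 / 8 * ε ^ 2 * Fintype.card ι)) := by
  set μ : Measure (κ → ℝ) := Measure.pi fun _ => gaussianReal 0 v with hμ
  set n := Fintype.card ι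
  -- Zero variance is split off because the Chernoff parameter below divides by $vw$.
  rcases eq_or_ne v 0 with rfl | hv
  · have hz : ∀ᵐ η ∂μ, ∀ q, η q = 0 := by
      rw [ae_all_iff]
      intro q
      have := (measurePreserving_eval (fun _ : κ => gaussianReal 0 0) q).quasiMeasurePreserving.ae
        (p := fun x => x = 0) (by simp [gaussianReal_zero_var, ae_dirac_eq])
      exact this
    have : μ.real {η | (1 + ε) ^ 2 * (((0 : NNReal) : ℝ) * w) * n <
        ∑ i, (∑ q, a i q * η q) ^ 2} = 0 := by
      rw [measureReal_eq_zero_iff]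
      refine measure_eq_zero_iff_ae_notMem.mpr ?_
      filter_upwards [hz] with η hη
      simp [hη]
    rw [this]; positivity
  have hvpos : (0 : ℝ) < v := by exact_mod_cast pos_iff_ne_zero.mpr hv
  set θ : ℝ := v * w with hθ
  have hθ0 : 0 < θ := mul_pos hvpos hw
  have ht2 : √(ε / (2 * θ)) ^ 2 = ε / (2 * θ) := Real.sq_sqrt (by positivity)
  have ht3 : √(ε / (2 * θ)) ^ 2 * θ = 2 * (ε / 4) := by rw [ht2]; field_simp; norm_num
  obtain ⟨hI, hE⟩ := integral_exp_sum_sq_gaussian v w a ha √(ε / (2 * θ))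
    (by rw [← hθ, ht3]; linarith)
  rw [← hθ, ht3, ht2] at hE
  rw [ht2] at hI
  have hM := mul_meas_ge_le_integral_of_nonneg
    (Filter.Eventually.of_forall fun η => (Real.exp_pos _).le) hI
    (Real.exp (ε / 4 * ((1 + ε) ^ 2 * n)))
  rw [hE] at hM
  have hsub : μ.real {η | (1 + ε) ^ 2 * θ * n < ∑ i, (∑ q, a i q * η q) ^ 2} ≤
      μ.real {η | Real.exp (ε / 4 * ((1 + ε) ^ 2 * n)) ≤
        Real.exp (ε / (2 * θ) / 2 * ∑ i, (∑ q, a i q * η q) ^ 2)} := by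
    refine measureReal_mono fun η hη => ?_
    simp only [Set.mem_ofPred_eq] at hη ⊢
    rw [Real.exp_le_exp]
    have := mul_le_mul_of_nonneg_left hη.le (by positivity : 0 ≤ ε / (2 * θ) / 2)
    refine le_trans (le_of_eq ?_) this
    field_simp; ring
  have hb := pow_le_pow_left₀ (by positivity)
    (inv_sqrt_one_sub_le (b := ε / 4) (by linarith) (by linarith)) n
  have h3 : Real.exp (ε / 4 * ((1 + ε) ^ 2 * n)) *
      μ.real {η | (1 + ε) ^ 2 * θ * n < ∑ i, (∑ q, a i q * η q) ^ 2} ≤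
      Real.exp (ε / 4 * ((1 + ε) ^ 2 * n)) * Real.exp (-(3 / 8 * ε ^ 2 * n)) := by
    refine (mul_le_mul_of_nonneg_left hsub (Real.exp_pos _).le).trans (hM.trans (hb.trans ?_))
    -- With $b=\varepsilon/4$,
    -- $b+2b^2-b(1+\varepsilon)^2=-\frac38\varepsilon^2-\frac14\varepsilon^3$.
    rw [← Real.exp_nat_mul, ← Real.exp_add, Real.exp_le_exp]
    have : 0 ≤ (n : ℝ) * ε ^ 3 := by positivity
    nlinarith
  exact le_of_mul_le_mul_left h3 (Real.exp_pos _)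

/-! ### Noise in the measurement vectors -/

/-- The coefficients of the noise in the `i`-th measurement at the grid point `g`. -/
noncomputable def noiseCoeff {m n N : ℕ} (g : Fin (2 * m + 1)) (i : Fin n) (q : Query m n N) : ℝ :=
  if q.1 = g ∧ q.2.1 = i then ((q.2.2.1 : ℤ) : ℝ) / N else 0

theorem measurements_eq_sum_noiseCoeff {m n N : ℕ} (η : Query m n N → ℝ) (g : Fin (2 * m + 1))
    (i : Fin n) : measurements η g i = ∑ q, noiseCoeff g i q * η q := by
  have huniv : (Finset.univ : Finset ℤˣ) = {1, -1} := rfl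
  have hne : (1 : ℤˣ) ≠ -1 := by decide
  have : ∀ q : Query m n N, noiseCoeff g i q * η q =
      if q.1 = g then if q.2.1 = i then ((q.2.2.1 : ℤ) : ℝ) / N * η q else 0 else 0 := by
    intro q
    unfold noiseCoeff
    split_ifs <;> simp_all
  simp only [this, Fintype.sum_prod_type, Finset.sum_ite_irrel, Finset.sum_const_zero,
    Finset.sum_ite_eq', Finset.mem_univ, if_true, huniv, Finset.sum_pair hne]
  simp only [measurements, average, Finset.sum_div, ← Finset.sum_sub_distrib,
    ← Finset.sum_add_distrib]
  refine Finset.sum_congr rfl fun r _ => ?_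
  simp; ring

/-- Distinct measurements use disjoint queries, and each has $2N$ coefficients $\pm1/N$. -/
theorem noiseCoeff_orthogonal {m n N : ℕ} (hN : 0 < N) (g : Fin (2 * m + 1)) (x : Fin n → ℝ) :
    ∑ q : Query m n N, (∑ i, x i * noiseCoeff g i q) ^ 2 = 2 / N * ∑ i, x i ^ 2 := by
  have : ∀ q : Query m n N, (∑ i, x i * noiseCoeff g i q) ^ 2 =
      if q.1 = g then x q.2.1 ^ 2 / N ^ 2 else 0 := by
    intro q
    rw [Finset.sum_eq_single q.2.1]
    · unfold noiseCoeff
      split_ifs with h1 h2 h2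
      · rcases Int.units_eq_one_or q.2.2.1 with h | h <;> simp [h] <;> ring
      · simp_all
      · simp_all
      · simp
    · intro j _ hj
      simp [noiseCoeff, hj.symm]
    · simp
  have hN' : (N : ℝ) ≠ 0 := by exact_mod_cast hN.ne'
  simp only [this, Fintype.sum_prod_type, Finset.sum_ite_irrel, Finset.sum_const_zero,
    Finset.sum_ite_eq', Finset.mem_univ, if_true, Finset.sum_const,
    Finset.card_univ, Fintype.card_prod, Fintype.card_units_int, Fintype.card_fin, nsmul_eq_mul, Finset.mul_sum]
  refine Finset.sum_congr rfl fun i _ => ?_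
  push_cast
  field_simp

/-- The law of the noise. -/
noncomputable abbrev noiseLaw (m n N : ℕ) (σ : ℝ) : Measure (Query m n N → ℝ) :=
  Measure.pi fun _ => gaussianReal 0 (σ ^ 2).toNNReal

/-- The noise in all measurement vectors is at most the radius of (P1). -/
def smallNoise (m n N : ℕ) (σ ε : ℝ) : Set (Query m n N → ℝ) :=
  {η | ∀ g, ∑ i, measurements η g i ^ 2 ≤ (1 + ε) ^ 2 * (σ ^ 2 * (2 / N)) * n}

theorem measurableSet_smallNoise (m n N : ℕ) (σ ε : ℝ) :
    MeasurableSet (smallNoise m n N σ ε) := by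
  simp only [smallNoise, measurements_eq_sum_noiseCoeff, Set.ofPred_forall]
  exact MeasurableSet.iInter fun g => measurableSet_le (by fun_prop) measurable_const

theorem noiseLaw_smallNoise {m n N : ℕ} (hN : 0 < N) (σ : ℝ) {ε : ℝ} (h0 : 0 < ε) (h1 : ε < 1)
    (hn : 2 * Real.log (2 * m + 1) ≤ 3 / 8 * ε ^ 2 * n) :
    1 - Real.exp (-(3 / 8 * ε ^ 2 * n / 2)) ≤ (noiseLaw m n N σ).real (smallNoise m n N σ ε) := by
  have hN' : (0 : ℝ) < N := by exact_mod_cast hN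
  have hbad : (noiseLaw m n N σ).real (smallNoise m n N σ ε)ᶜ ≤
      Real.exp (-(3 / 8 * ε ^ 2 * n / 2)) := by
    have hsub : (smallNoise m n N σ ε)ᶜ ⊆ ⋃ g, {η : Query m n N → ℝ |
        (1 + ε) ^ 2 * (((σ ^ 2).toNNReal : ℝ) * (2 / N)) * Fintype.card (Fin n) <
          ∑ i, (∑ q, noiseCoeff g i q * η q) ^ 2} := by
      intro η hη
      simpa [smallNoise, ← measurements_eq_sum_noiseCoeff, Real.coe_toNNReal _ (sq_nonneg σ)]
        using hη
    calc (noiseLaw m n N σ).real (smallNoise m n N σ ε)ᶜ ≤ _ := measureReal_mono hsub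
      _ ≤ _ := measureReal_iUnion_fintype_le _
      _ ≤ ∑ _g : Fin (2 * m + 1), Real.exp (-(3 / 8 * ε ^ 2 * Fintype.card (Fin n))) :=
          Finset.sum_le_sum fun g _ => gaussian_sum_sq_tail _ _ (by positivity) _
            (noiseCoeff_orthogonal hN g) h0 h1
      _ = Real.exp (Real.log (2 * m + 1)) * Real.exp (-(3 / 8 * ε ^ 2 * n)) := by
          rw [Real.exp_log (by positivity)]; simp
      _ ≤ Real.exp (-(3 / 8 * ε ^ 2 * n / 2)) := by
          rw [← Real.exp_add, Real.exp_le_exp]; linarith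
  rw [probReal_compl_eq_one_sub (measurableSet_smallNoise m n N σ ε)] at hbad
  linarith

/-! ### From measurements to deterministic support recovery -/

section Measurements

variable {d m n N : ℕ}

theorem gridValue_mem_Icc (hm : 0 < m) (g : Fin (2 * m + 1)) :
    gridValue m g ∈ Set.Icc (-1 : ℝ) 1 := by
  have hm' : (0 : ℝ) < m := by exact_mod_cast hm
  have hg : ((g : ℕ) : ℝ) ≤ 2 * m := by exact_mod_cast Nat.lt_succ_iff.mp g.2
  have hg0 : (0 : ℝ) ≤ (g : ℕ) := Nat.cast_nonneg _
  rw [gridValue, Set.mem_Icc, le_div_iff₀ hm', div_le_iff₀ hm']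
  constructor <;> linarith

theorem exists_gridValue_near (hm : 0 < m) {x : ℝ} (hx : x ∈ Set.Icc (-1 : ℝ) 1) :
    ∃ g : Fin (2 * m + 1), |x - gridValue m g| ≤ 1 / m := by
  have hm' : (0 : ℝ) < m := by exact_mod_cast hm
  have h0 : 0 ≤ m * (x + 1) := mul_nonneg hm'.le (by linarith [hx.1])
  have h1 := Nat.floor_le h0
  have h2 := Nat.lt_floor_add_one (m * (x + 1))
  have h3 : ⌊m * (x + 1)⌋₊ < 2 * m + 1 := by
    have : ((⌊m * (x + 1)⌋₊ : ℕ) : ℝ) ≤ (2 * m : ℕ) := by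
      push_cast; nlinarith [hx.2]
    exact Nat.lt_succ_of_le (by exact_mod_cast this)
  refine ⟨⟨_, h3⟩, ?_⟩
  have e : x - gridValue m ⟨_, h3⟩ = (m * (x + 1) - ⌊m * (x + 1)⌋₊) / m := by
    simp only [gridValue]; field_simp; ring
  rw [e, abs_of_nonneg (div_nonneg (by linarith) hm'.le)]
  gcongr
  linarith

theorem queryPoint_mem_Icc {x : ℝ} (hx : x ∈ Set.Icc (-1 : ℝ) 1) (b : Fin d → ℤˣ) (s : ℤˣ) :
    queryPoint x b s ∈ Set.Icc (-1 : Fin d → ℝ) 1 := by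
  constructor <;> intro j <;> simp only [queryPoint, Pi.neg_apply, Pi.one_apply] <;> split_ifs
  exacts [hx.1, by norm_num, hx.2, by norm_num]

theorem IsUnivariateSpam.sub_eq_sum {f : (Fin d → ℝ) → ℝ} {S : Finset (Fin d)}
    {φ : Fin d → ℝ → ℝ} {L α D : ℝ} (hf : IsUnivariateSpam f S φ L α D) {x : ℝ}
    (hx : x ∈ Set.Icc (-1 : ℝ) 1) (b : Fin d → ℤˣ) :
    f (queryPoint x b 1) - f (queryPoint x b (-1)) = ∑ p ∈ S, ((b p : ℤ) : ℝ) * φ p x := by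
  rw [hf.repr _ (queryPoint_mem_Icc hx b 1), hf.repr _ (queryPoint_mem_Icc hx b (-1)),
    add_sub_add_left_eq_sub, ← Finset.sum_sub_distrib]
  refine Finset.sum_congr rfl fun p hp => ?_
  have hne : (1 : ℤˣ) ≠ -1 := by decide
  rcases Int.units_eq_one_or (b p) with h | h <;>
    simp [queryPoint, h, hf.anchored p hp, hne, hne.symm]

/-- The vector of component values at a grid point. -/
def componentVector (S : Finset (Fin d)) (φ : Fin d → ℝ → ℝ) (x : ℝ) : Fin d → ℝ :=
  fun p => if p ∈ S then φ p x else 0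

theorem IsUnivariateSpam.measurements_answers {f : (Fin d → ℝ) → ℝ} {S : Finset (Fin d)}
    {φ : Fin d → ℝ → ℝ} {L α D : ℝ} (hf : IsUnivariateSpam f S φ L α D) (hm : 0 < m) (hN : 0 < N)
    (β : Fin n → Fin d → ℤˣ) (η : Query m n N → ℝ) (g : Fin (2 * m + 1)) :
    measurements (answers f β η) g =
      signMatrix β *ᵥ componentVector S φ (gridValue m g) + measurements η g := by
  have hN' : (N : ℝ) ≠ 0 := by exact_mod_cast hN.ne'
  ext i
  have h1 : (signMatrix β *ᵥ componentVector S φ (gridValue m g)) i =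
      f (queryPoint (gridValue m g) (β i) 1) - f (queryPoint (gridValue m g) (β i) (-1)) := by
    rw [hf.sub_eq_sum (gridValue_mem_Icc hm g)]
    simp [signMatrix, Matrix.mulVec, dotProduct, componentVector]
  have h2 : ∀ s, average (answers f β η) g i s =
      f (queryPoint (gridValue m g) (β i) s) + average η g i s := by
    intro s
    simp only [average, answers, Finset.sum_add_distrib, Finset.sum_const, Finset.card_univ,
      Fintype.card_fin, nsmul_eq_mul]
    field_simp
  rw [Pi.add_apply, h1, measurements, h2, h2, measurements]
  ring

end Measurements

/-- Deterministic part of support recovery. -/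
theorem estimatedSupport_eq {d m n N : ℕ} {f : (Fin d → ℝ) → ℝ} {S : Finset (Fin d)}
    {φ : Fin d → ℝ → ℝ} {L α D σ ε : ℝ} (hL : 0 < L) (hα : 0 < α) (hD : 0 < D) (hσ : 0 ≤ σ)
    (hε : 0 < ε) (hf : IsUnivariateSpam f S φ L α D) (hm : 0 < m) (hn : 0 < n)
    (hN : 18 * 3 ^ 2 * (1 + ε) ^ 2 * σ ^ 2 / D ^ 2 < N) (hmL : (3 * L / D) ^ (1 / α) ≤ (m : ℝ))
    {β : Fin n → Fin d → ℤˣ} {η : Query m n N → ℝ} (hβ : ConeBound (signMatrix β) S)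
    (hη : η ∈ smallNoise m n N σ ε)
    (rec : Matrix (Fin n) (Fin d) ℝ → (Fin n → ℝ) → (Fin d → ℝ))
    (hrec : IsP1Solver (√2 * (1 + ε) * σ * √((n : ℝ) / N)) rec) :
    estimatedSupport (√2 * 3 * (1 + ε) * σ / √(N : ℝ)) rec β (answers f β η) = S := by
  have hN0 : (0 : ℝ) < N := lt_of_le_of_lt (by positivity) hN
  have hN1 : 0 < N := by exact_mod_cast hN0
  have hn0 : (0 : ℝ) < n := by exact_mod_cast hn
  have hm0 : (0 : ℝ) < m := by exact_mod_cast hm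
  set ν := √2 * (1 + ε) * σ * √((n : ℝ) / N) with hν
  set τ := √2 * 3 * (1 + ε) * σ / √(N : ℝ) with hτ
  have hν0 : 0 ≤ ν := by positivity
  have hτν : 3 * ν / √n = τ := by
    have : 0 < √(n : ℝ) := Real.sqrt_pos.mpr hn0
    have : 0 < √(N : ℝ) := Real.sqrt_pos.mpr hN0
    rw [hν, hτ, Real.sqrt_div hn0.le]; field_simp
  -- Equivalent to $18(1+\varepsilon)^2\sigma^2/N<D^2/9$; the `+ 1` after the floor makes it strict.
  have hτD : τ < D / 3 := by
    refine lt_of_pow_lt_pow_left₀ 2 (by positivity) ?_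
    rw [hτ, div_pow, Real.sq_sqrt hN0.le, div_lt_iff₀ hN0]
    rw [div_lt_iff₀ (by positivity)] at hN
    have h2 : √(2 : ℝ) ^ 2 = 2 := Real.sq_sqrt (by norm_num)
    have : (√2 * 3 * (1 + ε) * σ) ^ 2 = 18 * (1 + ε) ^ 2 * σ ^ 2 := by
      rw [mul_pow, mul_pow, mul_pow, h2]; ring
    rw [this]; linarith
  set z : Fin (2 * m + 1) → Fin d → ℝ := fun g => componentVector S φ (gridValue m g) with hz
  have hzS : ∀ g, ∀ j ∉ S, z g j = 0 := fun g j hj => by simp [hz, componentVector, hj]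
  have hfeas : ∀ g, IsFeasible (signMatrix β) (measurements (answers f β η) g) ν (z g) := by
    intro g
    rw [IsFeasible, hf.measurements_answers hm hN1, add_sub_cancel_left]
    refine le_of_sq_le_sq ?_ hν0
    rw [EuclideanSpace.real_norm_sq_eq]
    refine (hη g).trans (le_of_eq ?_)
    rw [hν, mul_pow, mul_pow, mul_pow, Real.sq_sqrt (div_nonneg hn0.le hN0.le),
      Real.sq_sqrt (by norm_num)]
    ring
  have herr : ∀ g j,
      |rec (signMatrix β) (measurements (answers f β η) g) j - z g j| ≤ τ := by
    intro g j
    rw [← hτν]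
    exact hβ.abs_sub_le hn (hzS g) (hfeas g) (hrec _ _ (exists_isP1Solution (hfeas g))) j
  ext p
  simp only [estimatedSupport, Finset.mem_biUnion, Finset.mem_filter, Finset.mem_univ, true_and]
  constructor
  · rintro ⟨g, hg⟩
    by_contra hp
    have := herr g p
    rw [hzS g p hp, sub_zero] at this
    linarith
  · intro hp
    obtain ⟨x, hx, hDx⟩ := hf.identifiable p hp
    obtain ⟨g, hg⟩ := exists_gridValue_near hm hx
    refine ⟨g, ?_⟩
    have h1 := hf.holder p hp x hx _ (gridValue_mem_Icc hm g)
    have h2 : |x - gridValue m g| ^ α ≤ (1 / m : ℝ) ^ α :=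
      Real.rpow_le_rpow (abs_nonneg _) hg hα.le
    have h3 : 3 * L / D ≤ (m : ℝ) ^ α := by
      have := Real.rpow_le_rpow (by positivity) hmL hα.le
      rwa [← Real.rpow_mul (by positivity), one_div_mul_cancel hα.ne', Real.rpow_one] at this
    have h4 : L * |x - gridValue m g| ^ α ≤ D / 3 := by
      rw [Real.div_rpow zero_le_one hm0.le, Real.one_rpow] at h2
      have hmα : 0 < (m : ℝ) ^ α := Real.rpow_pos_of_pos hm0 _
      calc L * |x - gridValue m g| ^ α ≤ L * (1 / (m : ℝ) ^ α) := by gcongr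
        _ ≤ D / 3 := by
          rw [mul_one_div, div_le_div_iff₀ hmα (by norm_num)]
          rw [div_le_iff₀ hD] at h3
          linarith
    have h5 : z g p = φ p (gridValue m g) := by simp [hz, componentVector, hp]
    have h6 := herr g p
    -- The Hölder bound costs $D/3$ and the recovery error less than $D/3$, leaving more than
    -- $D/3>\tau$.
    have h7 := abs_sub_abs_le_abs_sub (φ p x) (φ p (gridValue m g))
    have h8 := abs_sub_abs_le_abs_sub (z g p)
      (rec (signMatrix β) (measurements (answers f β η) g) p)
    rw [abs_sub_comm] at h6
    rw [h5] at h6 h8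
    linarith

/-! ### Sample size and assembly -/

/-- The constant in the required number of sign vectors. -/
noncomputable def sampleConstant (κ : ℝ) : ℝ := 960 * (1 + Real.log 5 / Real.log (1 / κ))

theorem sampleConstant_pos {κ : ℝ} (h0 : 0 < κ) (h1 : κ < 1) : 0 < sampleConstant κ := by
  have h3 : 0 < Real.log (1 / κ) := Real.log_pos (by rw [lt_div_iff₀ h0]; linarith)
  have : 0 < Real.log 5 := Real.log_pos (by norm_num)
  unfold sampleConstant; positivity

/-- Here $\kappa$ enters: $\log(d/k)\ge\log(1/\kappa)>0$ lets a multiple of $\log(d/k)$ absorb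
$\log5$. -/
theorem sampleConstant_spec {κ : ℝ} (h0 : 0 < κ) (h1 : κ < 1) {k d : ℕ} (hk : 0 < k)
    (hkd : (k : ℝ) ≤ κ * d) :
    960 * k * Real.log (5 * d / k) ≤ sampleConstant κ * (k * Real.log (d / k)) := by
  have hk' : (0 : ℝ) < k := by exact_mod_cast hk
  have hd : (0 : ℝ) < d := pos_of_mul_pos_right (hk'.trans_le hkd) h0.le
  have hlog : 0 < Real.log (1 / κ) := Real.log_pos (by rw [lt_div_iff₀ h0]; linarith)
  have h5 : 0 < Real.log 5 := Real.log_pos (by norm_num)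
  have hle : Real.log (1 / κ) ≤ Real.log (d / k) := by
    refine Real.log_le_log (by positivity) ?_
    rw [div_le_div_iff₀ h0 hk']; linarith
  have h6 : Real.log 5 ≤ Real.log 5 / Real.log (1 / κ) * Real.log (d / k) := by
    rw [div_mul_eq_mul_div, le_div_iff₀ hlog]; gcongr
  rw [mul_div_assoc, Real.log_mul (by norm_num) (by positivity)]
  calc 960 * (k : ℝ) * (Real.log 5 + Real.log (d / k))
      ≤ 960 * k * (Real.log 5 / Real.log (1 / κ) * Real.log (d / k) + Real.log (d / k)) := by
        gcongr
    _ = _ := by unfold sampleConstant; ring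

theorem signLaw_coneBound {κ : ℝ} (h0 : 0 < κ) (h1 : κ < 1) {n d : ℕ} (S : Finset (Fin d))
    (hS : (S.card : ℝ) ≤ κ * d)
    (hn : sampleConstant κ * (S.card * Real.log (d / S.card)) ≤ n) :
    1 - Real.exp (-(1 / 192 * n)) ≤
      (signLaw n d).real {β | ConeBound (signMatrix β) S} := by
  rcases S.eq_empty_or_nonempty with rfl | hne
  · have : {β : Fin n → Fin d → ℤˣ | ConeBound (signMatrix β) ∅} = Set.univ := by
      ext β; simp [coneBound_empty]
    rw [this, probReal_univ]
    linarith [Real.exp_pos (-(1 / 192 * (n : ℝ)))]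
  · have hkd : S.card ≤ d := by simpa using S.card_le_univ
    refine (signLaw_lowerIsometry hne.card_pos hkd
      ((sampleConstant_spec h0 h1 hne.card_pos hS).trans hn)).trans ?_
    exact measureReal_mono fun β hβ => LowerIsometry.coneBound hne hβ

theorem card_query (m n N : ℕ) :
    Fintype.card (Query m n N) = 2 * (2 * m + 1) * n * N := by
  simp only [Fintype.card_prod, Fintype.card_fin, Fintype.card_units_int]; ring

end Spam

theorem mainTheorem6 :
    ∃ C₂ c₂ c₃ : ℝ, 0 < C₂ ∧ 0 < c₂ ∧ 0 < c₃ ∧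
      ∀ κ : ℝ, 0 < κ → κ < 1 → ∃ c₁ c₀ : ℝ, 0 < c₁ ∧ 0 < c₀ ∧
        ∀ (d m n N : ℕ) (f : (Fin d → ℝ) → ℝ) (S : Finset (Fin d)) (φ : Fin d → ℝ → ℝ)
          (L α D σ ε : ℝ),
          0 < L → 0 < α → α ≤ 1 → 0 < D → 0 ≤ σ → 0 < ε → ε < 1 →
          Spam.IsUnivariateSpam f S φ L α D →
          (S.card : ℝ) ≤ κ * d →
          ⌊18 * C₂ ^ 2 * (1 + ε) ^ 2 * σ ^ 2 / D ^ 2⌋₊ + 1 ≤ N →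
          (3 * L / D) ^ (1 / α) ≤ (m : ℝ) →
          max (c₁ * (S.card * Real.log (d / S.card)))
            (2 * Real.log (2 * m + 1) / (c₃ * ε ^ 2)) ≤ (n : ℝ) →
          (∃ E : Set ((Fin n → Fin d → ℤˣ) × (Spam.Query m n N → ℝ)), MeasurableSet E ∧
            1 - 2 * Real.exp (-(c₂ * n)) - 2 * Real.exp (-(c₃ * ε ^ 2 * n / 2)) ≤
              (Spam.runLaw d m n N σ).real E ∧
            ∀ ω ∈ E, ∀ rec : Matrix (Fin n) (Fin d) ℝ → (Fin n → ℝ) → (Fin d → ℝ),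
              Spam.IsP1Solver (√2 * (1 + ε) * σ * √((n : ℝ) / N)) rec →
              Spam.estimatedSupport (√2 * C₂ * (1 + ε) * σ / √(N : ℝ)) rec ω.1
                (Spam.answers f ω.1 ω.2) = S) ∧
          Fintype.card (Spam.Query m n N) = 2 * (2 * m + 1) * n * N ∧
          c₀ * ((1 + (3 * L / D) ^ (1 / α)) * (1 + σ ^ 2 / D ^ 2)) *
              (S.card * Real.log (d / S.card)) ≤
            (Fintype.card (Spam.Query m n N) : ℝ) := by
  refine ⟨3, 1 / 192, 3 / 8, by norm_num, by norm_num, by norm_num, fun κ hκ0 hκ1 => ?_⟩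
  have hc := Spam.sampleConstant_pos hκ0 hκ1
  refine ⟨Spam.sampleConstant κ, Spam.sampleConstant κ, hc, hc, ?_⟩
  intro d m n N f S φ L α D σ ε hL hα _ hD hσ hε0 hε1 hf hS hN hmL hn
  obtain ⟨hn1, hn2⟩ := max_le_iff.mp hn
  have hr : 0 < (3 * L / D) ^ (1 / α) := by positivity
  have hm0 : (0 : ℝ) < m := hr.trans_le hmL
  have hm : 0 < m := by exact_mod_cast hm0
  have hn0 : (0 : ℝ) < n := by
    refine lt_of_lt_of_le (div_pos (mul_pos two_pos (Real.log_pos ?_)) (by positivity)) hn2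
    linarith
  have hn' : 0 < n := by exact_mod_cast hn0
  have hNlt : 18 * 3 ^ 2 * (1 + ε) ^ 2 * σ ^ 2 / D ^ 2 < N :=
    (Nat.lt_floor_add_one _).trans_le (by exact_mod_cast hN)
  have hN' : 0 < N := by omega
  have hlog : 0 ≤ (S.card : ℝ) * Real.log (d / S.card) := by
    rcases Nat.eq_zero_or_pos S.card with h | h
    · simp [h]
    · have hk : (0 : ℝ) < S.card := by exact_mod_cast h
      refine mul_nonneg hk.le (Real.log_nonneg ?_)
      rw [one_le_div hk]
      exact hS.trans (mul_le_of_le_one_left (Nat.cast_nonneg _) hκ1.le)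
  refine ⟨⟨{β | Spam.ConeBound (Spam.signMatrix β) S} ×ˢ Spam.smallNoise m n N σ ε, ?_, ?_, ?_⟩,
    Spam.card_query m n N, ?_⟩
  · exact (Set.Finite.measurableSet (Set.toFinite _)).prod
      (Spam.measurableSet_smallNoise m n N σ ε)
  · have h1 := Spam.signLaw_coneBound hκ0 hκ1 S hS hn1
    have h2 := Spam.noiseLaw_smallNoise (m := m) hN' σ hε0 hε1 (n := n) (by
      rw [div_le_iff₀ (by positivity)] at hn2; linarith)
    rw [Spam.runLaw, measureReal_prod_prod]
    set a := (Spam.signLaw n d).real {β | Spam.ConeBound (Spam.signMatrix β) S}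
    set b := (Spam.noiseLaw m n N σ).real (Spam.smallNoise m n N σ ε)
    have ha : a ≤ 1 := measureReal_le_one
    have hb : b ≤ 1 := measureReal_le_one
    have e1 := Real.exp_pos (-(1 / 192 * (n : ℝ)))
    have e2 := Real.exp_pos (-(3 / 8 * ε ^ 2 * (n : ℝ) / 2))
    -- Independence gives $ab\ge a+b-1$; the factors $2$ in the claim are slack.
    nlinarith [mul_nonneg (sub_nonneg.mpr ha) (sub_nonneg.mpr hb)]
  · rintro ⟨β, η⟩ ⟨hβ, hη⟩ rec hrec
    exact Spam.estimatedSupport_eq hL hα hD hσ hε0 hf hm hn' hNlt hmL hβ hη rec hrec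
  · have h1 : 1 + σ ^ 2 / D ^ 2 ≤ 2 * N := by
      have h2 : (1 : ℝ) ≤ N := by exact_mod_cast hN'
      have h3 : σ ^ 2 / D ^ 2 ≤ 18 * 3 ^ 2 * (1 + ε) ^ 2 * σ ^ 2 / D ^ 2 := by
        gcongr
        nlinarith [sq_nonneg σ, mul_nonneg (sq_nonneg σ) hε0.le,
          mul_nonneg (sq_nonneg σ) (sq_nonneg ε)]
      linarith
    have h2 : 1 + (3 * L / D) ^ (1 / α) ≤ 2 * m + 1 := by linarith
    rw [Spam.card_query]
    push_cast
    -- The three factors are dominated separately by $2m+1$, $2N$ and $n$, so $c_0=\tilde c_1$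
    -- works.
    calc Spam.sampleConstant κ * ((1 + (3 * L / D) ^ (1 / α)) * (1 + σ ^ 2 / D ^ 2)) *
          ((S.card : ℝ) * Real.log (d / S.card))
        = ((1 + (3 * L / D) ^ (1 / α)) * (1 + σ ^ 2 / D ^ 2)) *
          (Spam.sampleConstant κ * ((S.card : ℝ) * Real.log (d / S.card))) := by ring
      _ ≤ ((2 * (m : ℝ) + 1) * (2 * N)) * n :=
          mul_le_mul (mul_le_mul h2 h1 (by positivity) (by positivity)) hn1
            (mul_nonneg hc.le hlog) (by positivity)
      _ = 2 * (2 * (m : ℝ) + 1) * n * N := by ring
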